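/- For integers $r \ge 2$ and $n \ge 2r+1$, let the Kneser graph $K(n,r)$ be the graph whose vertices are the $r$-element subsets of $\{1,\dots,n\}$, two vertices being adjacent if and only if they are disjoint. For a finite graph $G$, a vertex coloring is called distinguishing if no non-trivial automorphism $\sigma$ of $G$ fixes every color class (that is, satisfies $\sigma(C)=C$ for every color class $C$). The distinguishing number $D(G)$ is the least $k$ such that $G$ has a distinguishing coloring with $k$ available colors, and the list distinguishing number $D_l(G)$ is the least $k$ such that for every assignment of lists $L(v)$ of colors to the vertices $v$ of $G$ with $|L(v)|=k$ for all $v$, there is a distinguishing coloring $f$ of $G$ with $f(v)\in L(v)$ for all $v$. Theorem. For all $r\ge 2$ and $n\ge 2r+1$, $$D_l(K(n,r)) = D(K(n,r)).$$ Moreover, $D_l(K(n,r)) = 2$ if $(n,r)\neq(5,2)$, and $D_l(K(5,2)) = 3$. -/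

import Mathlib

/-- A vertex coloring `f` of `G` is distinguishing if the identity is the only automorphism `σ` of
`G` that fixes every color class, that is, `σ(f⁻¹(c)) = f⁻¹(c)` for all colors `c`. -/
def IsDistinguishing {V C : Type*} (G : SimpleGraph V) (f : V → C) : Prop :=
  ∀ σ : G ≃g G, (∀ c : C, σ '' (f ⁻¹' {c}) = f ⁻¹' {c}) → σ = RelIso.refl G.Adj

/-- `G` is `k`-distinguishable if it has a distinguishing coloring with `k` available colors. -/
def IsDistinguishable {V : Type*} (G : SimpleGraph V) (k : ℕ) : Prop :=
  ∃ f : V → Fin k, IsDistinguishing G f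

/-- The distinguishing number `D(G)` of a finite graph: the least `k` for which `G` is `k`-distinguishable. -/
noncomputable def distinguishingNumber {V : Type*} [Finite V] (G : SimpleGraph V) : ℕ :=
  sInf {k : ℕ | IsDistinguishable G k}

/-- Given lists `L(v)` of colors, `G` is `L`-distinguishable if it has a distinguishing coloring
`f` with `f v ∈ L v` for all vertices `v`. -/
def IsListDistinguishable {V C : Type*} (G : SimpleGraph V) (L : V → Finset C) : Prop :=
  ∃ f : V → C, (∀ v, f v ∈ L v) ∧ IsDistinguishing G f

/-- The list distinguishing number `D_l(G)` of a finite graph: the least `k` such that `G` is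
`L`-distinguishable for every assignment `L` of lists of exactly `k` colors.  Colors are natural
numbers, which is no restriction since finitely many finite lists use only finitely many colors. -/
noncomputable def listDistinguishingNumber {V : Type*} [Finite V] (G : SimpleGraph V) : ℕ :=
  sInf {k : ℕ | ∀ L : V → Finset ℕ, (∀ v, (L v).card = k) → IsListDistinguishable G L}

/-- The Kneser graph `K(n,r)`: its vertices are the `r`-element subsets of an `n`-element set, and
two distinct vertices are adjacent if and only if they are disjoint.  (The distinctness is
automatic for `r ≥ 1`.) -/
def kneserGraph (n r : ℕ) : SimpleGraph {s : Finset (Fin n) // s.card = r} where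
  Adj u v := u ≠ v ∧ Disjoint u.1 v.1
  symm := ⟨fun _ _ h => ⟨h.1.symm, h.2.symm⟩⟩
  loopless := ⟨fun _ h => h.1 rfl⟩

/-! For n ≥ 2r+1 every automorphism of K(n,r) comes from a permutation of the ground set
(`kneserGraph_iso_eq_perm`), so it suffices to color the r-sets from their lists so that only the
identity permutation preserves the colors (`RigidOn`).

A color-preserving permutation preserves star sums. If the star sum of `v` differs from all others,
then `v` is fixed, and rigidity need only be known on the remaining points. Each inequality between
star sums asks a 0-1 linear form in the free colors to avoid one value. When the forms have distinct
representatives, lists of size two suffice, by the Combinatorial Nullstellensatz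
(`exists_choice_sum_ne`). This gives two extension steps: adding a point when r = 2
(`exists_rigidOn_insert`), and passing from a rigid link of `v` to (r+1)-sets
(`exists_rigidOn_of_link`).

The start is r = 2 on at least six points. If two incident pairs have different lists, some triangle
can be colored with three distinct colors; otherwise all lists agree, and an asymmetric graph on six
vertices serves. For (5,2), lists of size three give a rainbow triangle, while two colors fail
because every graph on five vertices has a nontrivial automorphism. -/

open Finset

/-! ### Choosing colors by the Combinatorial Nullstellensatz -/

/-- The product of the polynomials `∑ i ∈ R x, X i - a x` has nonnegative coefficients in top degree,
and the coefficient of a product of representatives is positive. -/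
theorem coeff_prod_sum_X_sub_C {X ι : Type*} [DecidableEq ι] (A : Finset X) (R : X → Finset ι)
    (s : X → ι) (hsR : ∀ x ∈ A, s x ∈ R x) (a : X → ℤ) :
    let P := ∏ x ∈ A, ((∑ i ∈ R x, MvPolynomial.X i) - MvPolynomial.C (a x) : MvPolynomial ι ℤ)
    P.totalDegree ≤ #A ∧ (∀ m : ι →₀ ℕ, m.degree = #A → 0 ≤ P.coeff m) ∧
      0 < P.coeff (∑ x ∈ A, Finsupp.single (s x) 1) := by
  classical
  induction A using Finset.induction_on with
  | empty =>
    refine ⟨by simp, fun m _ => ?_, by simp⟩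
    simp only [prod_empty, MvPolynomial.coeff_one]
    split_ifs <;> simp
  | insert y A hy ih =>
    obtain ⟨h1, h2, h3⟩ := ih fun x hx => hsR x (mem_insert_of_mem hx)
    -- In top degree the constant `a y` contributes nothing, so the coefficient is a sum of
    -- top-degree coefficients of the smaller product; no cancellation can occur.
    have hcoeff : ∀ m : ι →₀ ℕ, m.degree = #A + 1 →
        MvPolynomial.coeff m (∏ x ∈ insert y A, ((∑ i ∈ R x, MvPolynomial.X i) -
          MvPolynomial.C (a x) : MvPolynomial ι ℤ)) =
        ∑ i ∈ R y, if i ∈ m.support then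
          MvPolynomial.coeff (m - Finsupp.single i 1) (∏ x ∈ A, ((∑ i ∈ R x, MvPolynomial.X i) -
          MvPolynomial.C (a x) : MvPolynomial ι ℤ)) else 0 := by
      intro m hm
      rw [prod_insert hy, mul_comm, mul_sub, MvPolynomial.coeff_sub,
        mul_comm _ (MvPolynomial.C (a y)), MvPolynomial.coeff_C_mul,
        MvPolynomial.coeff_eq_zero_of_totalDegree_lt (f := ∏ x ∈ A, _), mul_zero, sub_zero,
        mul_sum, MvPolynomial.coeff_sum]
      · simp only [MvPolynomial.coeff_mul_X']
      · change _ < m.degree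
        omega
    have hdeg : ∀ (m : ι →₀ ℕ) (i : ι), m.degree = #A + 1 → i ∈ m.support →
        (m - Finsupp.single i 1).degree = #A := by
      intro m i hm hi
      have hle : Finsupp.single i 1 ≤ m := by
        rw [Finsupp.single_le_iff]
        exact Nat.one_le_iff_ne_zero.2 (Finsupp.mem_support_iff.1 hi)
      have := congrArg Finsupp.degree (tsub_add_cancel_of_le hle)
      rw [map_add, Finsupp.degree_single, hm] at this
      omega
    have hnonneg : ∀ m : ι →₀ ℕ, m.degree = #A + 1 → ∀ i ∈ R y,
        0 ≤ if i ∈ m.support then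
          MvPolynomial.coeff (m - Finsupp.single i 1) (∏ x ∈ A, ((∑ i ∈ R x, MvPolynomial.X i) -
          MvPolynomial.C (a x) : MvPolynomial ι ℤ)) else 0 := by
      intro m hm i _
      split_ifs with hi
      · exact h2 _ (hdeg m i hm hi)
      · exact le_rfl
    refine ⟨?_, ?_, ?_⟩
    · rw [prod_insert hy, card_insert_of_notMem hy, add_comm]
      refine (MvPolynomial.totalDegree_mul _ _).trans (add_le_add ?_ h1)
      rw [sub_eq_add_neg, ← map_neg]
      refine (MvPolynomial.totalDegree_add _ _).trans (max_le ?_ ((MvPolynomial.totalDegree_C _).trans_le zero_le_one))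
      exact MvPolynomial.totalDegree_finsetSum_le fun i _ => by simp
    · intro m hm
      rw [card_insert_of_notMem hy] at hm
      rw [hcoeff m hm]
      exact sum_nonneg (hnonneg m hm)
    · have hm : (∑ x ∈ insert y A, Finsupp.single (s x) 1 : ι →₀ ℕ).degree = #A + 1 := by
        rw [map_sum]
        simp [card_insert_of_notMem hy]
      rw [hcoeff _ hm]
      refine sum_pos' (hnonneg _ hm) ⟨s y, hsR y (mem_insert_self _ _), ?_⟩
      rw [sum_insert hy, if_pos (by simp), add_tsub_cancel_left]
      exact h3

/-- List version of Alon's permanent lemma for nonnegative `0`-`1` forms: if the forms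
`∑ i ∈ R x, t i` have a system of distinct representatives, then the variables can be chosen from
lists of size two so that every form avoids a prescribed value. -/
theorem exists_choice_sum_ne {X ι : Type*} [Finite ι] (A : Finset X) (R : X → Finset ι)
    (s : X → ι) (hs : Set.InjOn s A) (hsR : ∀ x ∈ A, s x ∈ R x) (L : ι → Finset ℕ)
    (hL : ∀ i, 2 ≤ #(L i)) (a : X → ℤ) :
    ∃ t : ι → ℕ, (∀ i, t i ∈ L i) ∧ ∀ x ∈ A, ∑ i ∈ R x, (t i : ℤ) ≠ a x := by
  classical
  obtain ⟨h1, h2, h3⟩ := coeff_prod_sum_X_sub_C A R s hsR a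
  set P := ∏ x ∈ A, ((∑ i ∈ R x, MvPolynomial.X i) - MvPolynomial.C (a x) : MvPolynomial ι ℤ)
  have hdeg : (∑ x ∈ A, Finsupp.single (s x) 1 : ι →₀ ℕ).degree = #A := by
    rw [map_sum]; simp
  obtain ⟨t, ht, hne⟩ := MvPolynomial.combinatorial_nullstellensatz_exists_eval_nonzero P
    (∑ x ∈ A, Finsupp.single (s x) 1) h3.ne'
    (by
      refine le_antisymm (hdeg ▸ h1) ?_
      exact MvPolynomial.le_totalDegree (MvPolynomial.mem_support_iff.2 h3.ne'))
    -- Injectivity of `s` makes the chosen monomial squarefree, so lists of size two exceed every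
    -- exponent.
    (fun i => (L i).map Nat.castEmbedding) (by
      intro i
      rw [card_map]
      refine lt_of_le_of_lt ?_ (hL i)
      rw [Finsupp.finsetSum_apply]
      simp only [Finsupp.single_apply]
      rw [sum_boole, Nat.cast_id, card_le_one]
      intro x hx y hy
      rw [mem_filter] at hx hy
      exact hs hx.1 hy.1 (hx.2.trans hy.2.symm))
  have ht' : ∀ i, ∃ k ∈ L i, (k : ℤ) = t i := fun i => by simpa using ht i
  choose u huL hu using ht'
  refine ⟨u, huL, fun x hx h => hne ?_⟩
  rw [map_prod]
  refine prod_eq_zero hx ?_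
  simp [← hu, h]

/-! ### Rigidity and star sums -/

/-- Every permutation preserving `T` and the colors of the `r`-subsets of `T` fixes `T` pointwise. -/
def RigidOn {α : Type*} (r : ℕ) (T : Finset α) (f : Finset α → ℕ) : Prop :=
  ∀ σ : Equiv.Perm α, T.map σ.toEmbedding = T →
    (∀ S ⊆ T, #S = r → f (S.map σ.toEmbedding) = f S) → ∀ x ∈ T, σ x = x

/-- The sum of the colors of the `r`-subsets of `T` containing `x`. -/
def starSum {α : Type*} [DecidableEq α] (r : ℕ) (T : Finset α) (f : Finset α → ℕ) (x : α) : ℤ :=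
  ∑ S ∈ powersetCard r T with x ∈ S, (f S : ℤ)

section

variable {α : Type*} [DecidableEq α]

theorem starSum_perm {r : ℕ} {T : Finset α} {f : Finset α → ℕ} {σ : Equiv.Perm α}
    (hT : T.map σ.toEmbedding = T)
    (hf : ∀ S ⊆ T, #S = r → f (S.map σ.toEmbedding) = f S) (x : α) :
    starSum r T f (σ x) = starSum r T f x := by
  symm
  refine sum_equiv σ.finsetCongr (fun S => ?_) (fun S hS => ?_)
  · simp only [mem_filter, mem_powersetCard, Equiv.finsetCongr_apply, card_map]
    nth_rw 2 [← hT]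
    rw [map_subset_map]
    simp
  · simp only [mem_filter, mem_powersetCard] at hS
    rw [Equiv.finsetCongr_apply, hf S hS.1.1 hS.1.2]

/-- Sets containing both points cancel. In each extension step this leaves only free colors on one
side and only prescribed colors on the other. -/
theorem starSum_eq_iff {r : ℕ} {T : Finset α} {f : Finset α → ℕ} {v x : α} :
    starSum r T f v = starSum r T f x ↔
      ∑ S ∈ powersetCard r T with v ∈ S ∧ x ∉ S, (f S : ℤ) =
        ∑ S ∈ powersetCard r T with x ∈ S ∧ v ∉ S, (f S : ℤ) := by
  have key : ∀ v x : α, starSum r T f v = ∑ S ∈ powersetCard r T with v ∈ S ∧ x ∈ S, (f S : ℤ) +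
      ∑ S ∈ powersetCard r T with v ∈ S ∧ x ∉ S, (f S : ℤ) := by
    intro v x
    rw [starSum, ← sum_filter_add_sum_filter_not _ (fun S => x ∈ S), filter_filter, filter_filter]
  rw [key v x, key x v]
  simp only [and_comm (a := x ∈ _) (b := v ∈ _)]
  exact add_right_inj _

theorem map_eq_of_map_insert_eq {T : Finset α} {v : α} (hv : v ∉ T) {σ : Equiv.Perm α}
    (hT : (insert v T).map σ.toEmbedding = insert v T) (hσ : σ v = v) :
    T.map σ.toEmbedding = T := by
  rw [map_insert, Equiv.coe_toEmbedding, hσ] at hT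
  have hv' : v ∉ T.map σ.toEmbedding := by
    intro h
    obtain ⟨x, hx, hxv⟩ := mem_map.1 h
    exact hv (σ.injective (hxv.trans hσ.symm) ▸ hx)
  rw [← erase_insert hv', hT, erase_insert hv]

theorem perm_apply_eq_of_starSum_ne {r : ℕ} {T : Finset α} {f : Finset α → ℕ} {v : α}
    (hne : ∀ x ∈ T, starSum r (insert v T) f v ≠ starSum r (insert v T) f x) {σ : Equiv.Perm α}
    (hT : (insert v T).map σ.toEmbedding = insert v T)
    (hf : ∀ S ⊆ insert v T, #S = r → f (S.map σ.toEmbedding) = f S) : σ v = v := by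
  have hmem : σ v ∈ insert v T := by
    rw [← hT]; simp
  rcases mem_insert.1 hmem with h | h
  · exact h
  · exact absurd (starSum_perm hT hf v).symm (hne _ h)

theorem RigidOn.insert {r : ℕ} {T : Finset α} {f : Finset α → ℕ} {v : α} (hv : v ∉ T)
    (hne : ∀ x ∈ T, starSum r (insert v T) f v ≠ starSum r (insert v T) f x)
    (h : RigidOn r T f) : RigidOn r (insert v T) f := by
  intro σ hT hf
  have hσ := perm_apply_eq_of_starSum_ne hne hT hf
  intro x hx
  rcases mem_insert.1 hx with rfl | hx
  · exact hσ
  · exact h σ (map_eq_of_map_insert_eq hv hT hσ)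
      (fun S hS => hf S (hS.trans (subset_insert _ _))) x hx

/-- Once `v` is fixed, a color-preserving permutation also preserves the coloring that the sets
through `v` induce on the link of `v`. -/
theorem RigidOn.of_link {r : ℕ} {T : Finset α} {f : Finset α → ℕ} {v : α} (hv : v ∉ T)
    (hne : ∀ x ∈ T, starSum (r + 1) (Insert.insert v T) f v ≠
      starSum (r + 1) (Insert.insert v T) f x)
    (h : RigidOn r T fun S => f (Insert.insert v S)) :
    RigidOn (r + 1) (Insert.insert v T) f := by
  intro σ hT hf
  have hσ := perm_apply_eq_of_starSum_ne hne hT hf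
  intro x hx
  rcases mem_insert.1 hx with rfl | hx
  · exact hσ
  · refine h σ (map_eq_of_map_insert_eq hv hT hσ) (fun S hS hr => ?_) x hx
    have := hf (Insert.insert v S) (insert_subset_insert _ hS)
      (by rw [card_insert_of_notMem fun h => hv (hS h), hr])
    rwa [map_insert, Equiv.coe_toEmbedding, hσ] at this

/-! ### Extending rigid colorings by one point -/

theorem exists_fixedPointFree (T : Finset α) (hT : 2 ≤ #T) :
    ∃ σ : Equiv.Perm α, ∀ x ∈ T, σ x ∈ T ∧ σ x ≠ x := by
  obtain ⟨σ, hσ⟩ : ∃ σ : Equiv.Perm α, σ.IsCycleOn T := by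
    refine ⟨T.toList.formPerm, ?_⟩
    convert! T.nodup_toList.isCycleOn_formPerm
    simp
  have hnt : (T : Set α).Nontrivial := one_lt_card_iff_nontrivial.1 hT
  exact ⟨σ, fun x hx => ⟨hσ.1.mapsTo hx, hσ.apply_ne hnt hx⟩⟩

/-- Inside a subset `U` of size r+1, a point `x` is represented by `U` minus `σ x`, with `σ`
fixed-point free. A point outside `U` is adjoined to a fixed (r-1)-subset of `U`. -/
theorem exists_injOn_mem_powersetCard {r : ℕ} (hr : 1 ≤ r) {T : Finset α} (hT : r + 1 ≤ #T) :
    ∃ s : α → Finset α, Set.InjOn s T ∧ ∀ x ∈ T, s x ∈ powersetCard r T ∧ x ∈ s x := by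
  obtain ⟨U, hU, hUc⟩ := exists_subset_card_eq hT
  obtain ⟨σ, hσ⟩ := exists_fixedPointFree U (by omega)
  obtain ⟨B, hB, hBc⟩ := exists_subset_card_eq (s := U) (n := r - 1) (by omega)
  refine ⟨fun x => if x ∈ U then U.erase (σ x) else insert x B, ?_, ?_⟩
  · intro x hx y hy hxy
    dsimp only at hxy
    split_ifs at hxy with h1 h2 h2
    · have h3 : σ y ∉ U.erase (σ x) := by rw [hxy]; simp
      by_contra hne
      exact h3 (mem_erase.2 ⟨fun h => hne (σ.injective h.symm), (hσ y h2).1⟩)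
    · exact absurd (erase_subset _ _ (hxy ▸ mem_insert_self y B)) h2
    · exact absurd (erase_subset _ _ (hxy ▸ mem_insert_self x B)) h1
    · have h3 : x ∈ insert y B := hxy ▸ mem_insert_self x B
      rcases mem_insert.1 h3 with h | h
      · exact h
      · exact absurd (hB h) h1
  · intro x hx
    dsimp only
    rw [mem_powersetCard]
    split_ifs with h1
    · refine ⟨⟨(erase_subset _ _).trans hU, ?_⟩, mem_erase.2 ⟨(hσ x h1).2.symm, h1⟩⟩
      rw [card_erase_of_mem (hσ x h1).1]; omega
    · refine ⟨⟨insert_subset hx (hB.trans hU), ?_⟩, mem_insert_self _ _⟩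
      rw [card_insert_of_notMem fun h => h1 (hB h)]; omega

variable [Finite α]

/-- Old pairs keep their colors and pairs through `v` are free. The form for `x` involves the pairs
through `v` avoiding `x`, and {v, σ x} represents it for a fixed-point-free `σ`. -/
theorem exists_rigidOn_insert {T : Finset α} (hT : 2 ≤ #T) {v : α} (hv : v ∉ T)
    {L : Finset α → Finset ℕ} (hL : ∀ S, 2 ≤ #(L S)) {f : Finset α → ℕ} (hfL : ∀ S, f S ∈ L S)
    (hf : RigidOn 2 T f) : ∃ g : Finset α → ℕ, (∀ S, g S ∈ L S) ∧ RigidOn 2 (insert v T) g := by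
  obtain ⟨σ, hσ⟩ := exists_fixedPointFree T hT
  have hvT : ∀ x ∈ T, x ≠ v := fun x hx h => hv (h ▸ hx)
  obtain ⟨t, htL, ht⟩ := exists_choice_sum_ne T
    (fun x => {S ∈ powersetCard 2 (insert v T) | v ∈ S ∧ x ∉ S}) (fun x => {v, σ x})
    (by
      intro x hx y hy hxy
      have h : σ x ∈ ({v, σ y} : Finset α) := by
        rw [← show ({v, σ x} : Finset α) = {v, σ y} from hxy]; simp
      rcases mem_insert.1 h with h | h
      · exact absurd h (hvT _ (hσ x hx).1)
      · exact σ.injective (mem_singleton.1 h))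
    (by
      intro x hx
      rw [mem_filter, mem_powersetCard]
      refine ⟨⟨?_, card_pair (hvT _ (hσ x hx).1).symm⟩, by simp, ?_⟩
      · exact insert_subset_insert _ (singleton_subset_iff.2 (hσ x hx).1)
      · simp [hvT x hx, (hσ x hx).2.symm])
    L hL (fun x => ∑ S ∈ powersetCard 2 (insert v T) with x ∈ S ∧ v ∉ S, (f S : ℤ))
  refine ⟨fun S => if v ∈ S then t S else f S, fun S => ?_, RigidOn.insert hv ?_ ?_⟩
  · dsimp only
    split_ifs
    exacts [htL S, hfL S]
  · intro x hx h
    rw [starSum_eq_iff] at h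
    refine ht x hx ?_
    convert h using 1
    · exact sum_congr rfl fun S hS => by rw [if_pos (mem_filter.1 hS).2.1]
    · exact sum_congr rfl fun S hS => by rw [if_neg (mem_filter.1 hS).2.2]
  · intro τ hτ hτf
    refine hf τ hτ fun S hS hr => ?_
    have := hτf S hS hr
    have h1 : v ∉ S := fun h => hv (hS h)
    have h2 : v ∉ S.map τ.toEmbedding := fun h => hv (hτ ▸ map_subset_map.2 hS h)
    simpa only [if_neg h1, if_neg h2] using this

theorem exists_rigidOn_superset {T₀ T : Finset α} (hT₀ : 2 ≤ #T₀) (hT : T₀ ⊆ T)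
    {L : Finset α → Finset ℕ} (hL : ∀ S, 2 ≤ #(L S))
    (h₀ : ∃ f : Finset α → ℕ, (∀ S, f S ∈ L S) ∧ RigidOn 2 T₀ f) :
    ∃ f : Finset α → ℕ, (∀ S, f S ∈ L S) ∧ RigidOn 2 T f := by
  obtain ⟨V, rfl⟩ : ∃ V, T = V ∪ T₀ := ⟨T, (union_eq_left.2 hT).symm⟩
  clear hT
  induction V using Finset.induction_on with
  | empty => simpa using h₀
  | insert v V _ ih =>
    obtain ⟨f, hfL, hf⟩ := ih
    rw [insert_union]
    by_cases hv : v ∈ V ∪ T₀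
    · rw [insert_eq_of_mem hv]
      exact ⟨f, hfL, hf⟩
    · exact exists_rigidOn_insert (hT₀.trans (card_le_card subset_union_right)) hv hL hfL hf

/-- The roles are reversed here: sets through `v` carry the rigid coloring of the link, and sets
avoiding `v` are free to separate the star sum of `v` from the others. -/
theorem exists_rigidOn_of_link {r : ℕ} {T : Finset α} (hT : r + 2 ≤ #T) {v : α}
    (hv : v ∉ T) {L : Finset α → Finset ℕ} (hL : ∀ S, 2 ≤ #(L S)) {f : Finset α → ℕ}
    (hfL : ∀ S, f S ∈ L (insert v S)) (hf : RigidOn r T f) :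
    ∃ g : Finset α → ℕ, (∀ S, g S ∈ L S) ∧ RigidOn (r + 1) (insert v T) g := by
  obtain ⟨s, hs, hsT⟩ := exists_injOn_mem_powersetCard (r := r + 1) (by omega) hT
  obtain ⟨t, htL, ht⟩ := exists_choice_sum_ne T
    (fun x => {S ∈ powersetCard (r + 1) (insert v T) | x ∈ S ∧ v ∉ S}) s hs
    (by
      intro x hx
      obtain ⟨h1, h2⟩ := hsT x hx
      rw [mem_powersetCard] at h1
      rw [mem_filter, mem_powersetCard]
      exact ⟨⟨h1.1.trans (subset_insert _ _), h1.2⟩, h2, fun h => hv (h1.1 h)⟩)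
    L hL (fun x => ∑ S ∈ powersetCard (r + 1) (insert v T) with v ∈ S ∧ x ∉ S,
      (f (S.erase v) : ℤ))
  refine ⟨fun S => if v ∈ S then f (S.erase v) else t S, fun S => ?_, RigidOn.of_link hv ?_ ?_⟩
  · dsimp only
    split_ifs with h
    · have := hfL (S.erase v)
      rwa [insert_erase h] at this
    · exact htL S
  · intro x hx h
    rw [starSum_eq_iff] at h
    refine ht x hx ?_
    convert h.symm using 1
    · exact sum_congr rfl fun S hS => by rw [if_neg (mem_filter.1 hS).2.2]
    · exact sum_congr rfl fun S hS => by rw [if_pos (mem_filter.1 hS).2.1]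
  · intro τ hτ hτf
    refine hf τ hτ fun S hS hr => ?_
    have := hτf S hS hr
    have h1 : v ∉ S := fun h => hv (hS h)
    have h2 : v ∉ S.map τ.toEmbedding := fun h => hv (hτ ▸ map_subset_map.2 hS h)
    simpa only [mem_insert_self, if_true, erase_insert h1, erase_insert h2] using this

end

/-! ### Small rigid configurations -/

section

variable {α : Type*} [DecidableEq α]

theorem perm_apply_eq_of_map_eq {r : ℕ} (hr : 1 ≤ r) {T : Finset α} (hT : r < #T)
    {σ : Equiv.Perm α} (hσ : T.map σ.toEmbedding = T)
    (h : ∀ S ⊆ T, #S = r → S.map σ.toEmbedding = S) {x : α} (hx : x ∈ T) : σ x = x := by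
  by_contra hne
  have hmem : σ x ∈ T := by rw [← hσ]; simpa using hx
  obtain ⟨S, hxS, hST, hS⟩ := exists_subsuperset_card_eq (s := {x}) (t := T.erase (σ x)) (n := r)
    (singleton_subset_iff.2 (mem_erase.2 ⟨Ne.symm hne, hx⟩)) (by simpa using hr)
    (by rw [card_erase_of_mem hmem]; omega)
  have h1 : σ x ∈ S := by
    rw [← h S (hST.trans (erase_subset _ _)) hS]
    exact mem_map_of_mem _ (singleton_subset_iff.1 hxS)
  exact (mem_erase.1 (hST h1)).1 rfl

theorem RigidOn.of_injOn {r : ℕ} (hr : 1 ≤ r) {T : Finset α} (hT : r < #T) {f : Finset α → ℕ}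
    (hf : Set.InjOn f (powersetCard r T)) : RigidOn r T f := by
  intro σ hσ hσf x hx
  refine perm_apply_eq_of_map_eq hr hT hσ (fun S hST hS => ?_) hx
  refine hf ?_ (mem_coe.2 (mem_powersetCard.2 ⟨hST, hS⟩)) (hσf S hST hS)
  rw [mem_coe, mem_powersetCard, card_map]
  exact ⟨(map_subset_map.2 hST).trans hσ.le, hS⟩

/-- Three lists of size two can be chosen from injectively unless they are all equal. -/
theorem exists_rigidOn_triangle {T : Finset α} (hT : #T = 3) {L : Finset α → Finset ℕ}
    (hL : ∀ S, 2 ≤ #(L S)) (hU : 3 ≤ #((powersetCard 2 T).biUnion L)) :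
    -- Hall's condition holds for at most two pairs by list size, and for all three by `hU`. A
    -- rainbow triangle is rigid.
    ∃ f : Finset α → ℕ, (∀ S, f S ∈ L S) ∧ RigidOn 2 T f := by
  have hP : #(powersetCard 2 T) = 3 := by rw [card_powersetCard, hT]; rfl
  obtain ⟨g, hg, hgL⟩ := (all_card_le_biUnion_card_iff_exists_injective
    (fun S : powersetCard 2 T => L S)).1 (by
      intro s
      rcases s.eq_empty_or_nonempty with rfl | ⟨S, hS⟩
      · simp
      by_cases hs : #s ≤ 2
      · exact hs.trans ((hL S).trans (card_le_card (subset_biUnion_of_mem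
          (fun S : powersetCard 2 T => L S) hS)))
      · have hle : #s ≤ 3 := by
          rw [← hP, ← Fintype.card_coe (powersetCard 2 T)]
          exact card_le_univ s
        have hs' : s = univ := by
          rw [← card_eq_iff_eq_univ, Fintype.card_coe]; omega
        refine hle.trans (hU.trans (card_le_card ?_))
        intro c hc
        obtain ⟨S, hS, hcS⟩ := mem_biUnion.1 hc
        exact mem_biUnion.2 ⟨⟨S, hS⟩, hs' ▸ mem_univ _, hcS⟩)
  have hne : ∀ S, ∃ c, c ∈ L S := fun S => card_pos.1 (lt_of_lt_of_le two_pos (hL S))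
  choose d hd using hne
  refine ⟨fun S => if h : S ∈ powersetCard 2 T then g ⟨S, h⟩ else d S, fun S => ?_,
    RigidOn.of_injOn one_le_two (by omega) ?_⟩
  · dsimp only
    split_ifs with h
    exacts [hgL ⟨S, h⟩, hd S]
  · intro S hS S' hS' h
    rw [mem_coe] at hS hS'
    dsimp only at h
    rw [dif_pos hS, dif_pos hS'] at h
    exact congrArg Subtype.val (hg h)

end

/-- A graph on six vertices without nontrivial automorphisms: a triangle `123` with pendant paths
`10` and `345`. -/
def asymmetricAdj (i j : Fin 6) : Bool :=
  (i, j) ∈ [(0, 1), (1, 0), (1, 2), (2, 1), (2, 3), (3, 2), (1, 3), (3, 1), (3, 4), (4, 3),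
    (4, 5), ((5, 4) : Fin 6 × Fin 6)]

-- Images of the six vertices are introduced one at a time, with the adjacency constraints
-- interleaved so that the exhaustive search is pruned early.
set_option maxRecDepth 100000 in
set_option synthInstance.maxSize 10000 in
set_option synthInstance.maxHeartbeats 400000 in
set_option maxHeartbeats 4000000 in
theorem asymmetricAdj_rigid_aux :
    ∀ a b : Fin 6, a ≠ b → asymmetricAdj a b = true →
    ∀ c, c ≠ a → c ≠ b → asymmetricAdj a c = false → asymmetricAdj b c = true →
    ∀ d, d ≠ a → d ≠ b → d ≠ c → asymmetricAdj a d = false → asymmetricAdj b d = true →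
      asymmetricAdj c d = true →
    ∀ e, e ≠ a → e ≠ b → e ≠ c → e ≠ d → asymmetricAdj a e = false → asymmetricAdj b e = false →
      asymmetricAdj c e = false → asymmetricAdj d e = true →
    ∀ f, f ≠ a → f ≠ b → f ≠ c → f ≠ d → f ≠ e → asymmetricAdj e f = true →
      a = 0 ∧ b = 1 ∧ c = 2 ∧ d = 3 ∧ e = 4 ∧ f = 5 := by
  decide

theorem asymmetricAdj_rigid (p : Fin 6 → Fin 6) (hp : Function.Injective p)
    (h : ∀ i j, i ≠ j → asymmetricAdj (p i) (p j) = asymmetricAdj i j) (i : Fin 6) : p i = i := by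
  have key := asymmetricAdj_rigid_aux (p 0) (p 1) (hp.ne (by decide)) (h _ _ (by decide))
    (p 2) (hp.ne (by decide)) (hp.ne (by decide)) (h _ _ (by decide)) (h _ _ (by decide))
    (p 3) (hp.ne (by decide)) (hp.ne (by decide)) (hp.ne (by decide)) (h _ _ (by decide))
    (h _ _ (by decide)) (h _ _ (by decide))
    (p 4) (hp.ne (by decide)) (hp.ne (by decide)) (hp.ne (by decide)) (hp.ne (by decide))
    (h _ _ (by decide)) (h _ _ (by decide)) (h _ _ (by decide)) (h _ _ (by decide))
    (p 5) (hp.ne (by decide)) (hp.ne (by decide)) (hp.ne (by decide)) (hp.ne (by decide))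
    (hp.ne (by decide)) (h _ _ (by decide))
  obtain ⟨h0, h1, h2, h3, h4, h5⟩ := key
  fin_cases i <;> assumption

section

variable {α : Type*} [DecidableEq α]

/-- Two colors common to all the lists mark the edges and the non-edges of the asymmetric graph,
transported to `T`. -/
theorem exists_rigidOn_of_list_eq {T : Finset α} (hT : #T = 6) {L : Finset α → Finset ℕ}
    (hL : ∀ S, 2 ≤ #(L S)) {c : Finset ℕ} (hc : ∀ S ∈ powersetCard 2 T, L S = c) :
    ∃ f : Finset α → ℕ, (∀ S, f S ∈ L S) ∧ RigidOn 2 T f := by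
  classical
  let e : Fin 6 ≃ T := (T.equivFinOfCardEq hT).symm
  have hne : ∀ S, ∃ c, c ∈ L S := fun S => card_pos.1 (lt_of_lt_of_le two_pos (hL S))
  choose d hd using hne
  have hpair : ∀ i j, i ≠ j → ({(e i : α), (e j : α)} : Finset α) ∈ powersetCard 2 T := by
    intro i j hij
    rw [mem_powersetCard]
    exact ⟨insert_subset (e i).2 (singleton_subset_iff.2 (e j).2),
      card_pair fun h => hij (e.injective (Subtype.ext h))⟩
  obtain ⟨a, ha, b, hb, hab⟩ : ∃ a ∈ c, ∃ b ∈ c, a ≠ b := by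
    refine one_lt_card.1 ?_
    rw [← hc _ (hpair 0 1 (by decide))]
    exact hL _
  let E : Finset α → Prop := fun S => ∃ i j, asymmetricAdj i j = true ∧ S = {(e i : α), (e j : α)}
  have hE : ∀ i j, E {(e i : α), (e j : α)} ↔ asymmetricAdj i j = true := by
    intro i j
    refine ⟨?_, fun h => ⟨i, j, h, rfl⟩⟩
    rintro ⟨i', j', h, hS⟩
    have hinj : ∀ k l, (e k : α) = e l → k = l := fun k l h => e.injective (Subtype.ext h)
    rw [← coe_inj, coe_pair, coe_pair, Set.pair_eq_pair_iff] at hS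
    rcases hS with ⟨h1, h2⟩ | ⟨h1, h2⟩
    · rwa [hinj _ _ h1, hinj _ _ h2]
    · rw [hinj _ _ h1, hinj _ _ h2]
      revert h
      clear * -
      revert i' j'
      decide
  refine ⟨fun S => if S ∈ powersetCard 2 T then if E S then a else b else d S, fun S => ?_, ?_⟩
  · dsimp only
    split_ifs with h1 h2
    exacts [hc S h1 ▸ ha, hc S h1 ▸ hb, hd S]
  · intro σ hσ hσf x hx
    have hmem : ∀ i, σ (e i) ∈ T := fun i =>
      hσ.subset (mem_map_of_mem σ.toEmbedding (e i).2)
    let p : Fin 6 → Fin 6 := fun i => e.symm ⟨σ (e i), hmem i⟩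
    have hpe : ∀ i, (e (p i) : α) = σ (e i) := fun i => by simp [p]
    have hpinj : Function.Injective p := by
      intro i j hij
      refine e.injective (Subtype.ext (σ.injective ?_))
      rw [← hpe, ← hpe, hij]
    have hp := asymmetricAdj_rigid p hpinj (fun i j hij => by
      have h := hσf {(e i : α), (e j : α)} (mem_powersetCard.1 (hpair i j hij)).1
        (mem_powersetCard.1 (hpair i j hij)).2
      rw [map_insert, map_singleton, Equiv.coe_toEmbedding, ← hpe, ← hpe] at h
      dsimp only at h
      rw [if_pos (hpair _ _ hij), if_pos (hpair _ _ (hpinj.ne hij))] at h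
      simp only [hE] at h
      cases h1 : asymmetricAdj (p i) (p j) <;> cases h2 : asymmetricAdj i j <;>
        rw [h1, h2] at h <;> simp [hab, hab.symm] at h ⊢)
    have := hpe (e.symm ⟨x, hx⟩)
    rw [hp] at this
    simpa using this.symm

/-! ### Rigid colorings from arbitrary lists -/

variable [Finite α]

theorem exists_rigidOn_two {T : Finset α} (hT : 6 ≤ #T) {L : Finset α → Finset ℕ}
    (hL : ∀ S, 2 ≤ #(L S)) : ∃ f : Finset α → ℕ, (∀ S, f S ∈ L S) ∧ RigidOn 2 T f := by
  by_cases h : ∃ x ∈ T, ∃ y ∈ T, ∃ z ∈ T, x ≠ y ∧ y ≠ z ∧ x ≠ z ∧ L {x, y} ≠ L {y, z}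
  · obtain ⟨x, hx, y, hy, z, hz, hxy, hyz, hxz, hne⟩ := h
    have hc : #({x, y, z} : Finset α) = 3 := card_eq_three.2 ⟨x, y, z, hxy, hxz, hyz, rfl⟩
    refine exists_rigidOn_superset (T₀ := {x, y, z}) (by omega) (by simp [insert_subset_iff, *])
      hL (exists_rigidOn_triangle hc hL ?_)
    -- If the triangle's lists had a union of at most two colors, each list would equal that union.
    by_contra hlt
    have hsub : ∀ u w, u ≠ w → u ∈ ({x, y, z} : Finset α) → w ∈ ({x, y, z} : Finset α) →
        L {u, w} = (powersetCard 2 {x, y, z}).biUnion L := by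
      intro u w huw hu hw
      refine eq_of_subset_of_card_le (subset_biUnion_of_mem L ?_) ?_
      · rw [mem_powersetCard]
        exact ⟨insert_subset hu (singleton_subset_iff.2 hw), card_pair huw⟩
      · have := hL {u, w}
        omega
    exact hne ((hsub x y hxy (by simp) (by simp)).trans (hsub y z hyz (by simp) (by simp)).symm)
  -- Incident pairs now have equal lists, and any two pairs are linked through pairs at `x₀`, so all
  -- lists on `T` coincide.
  · push Not at h
    obtain ⟨U, hU, hUc⟩ := exists_subset_card_eq hT
    obtain ⟨x₀, hx₀, y₀, hy₀, hxy₀⟩ := one_lt_card.1 (show 1 < #T by omega)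
    refine exists_rigidOn_superset (by omega) hU hL
      (exists_rigidOn_of_list_eq hUc hL (c := L {x₀, y₀}) fun S hS => ?_)
    rw [mem_powersetCard] at hS
    obtain ⟨x, y, hxy, rfl⟩ := card_eq_two.1 hS.2
    have hx : x ∈ T := hU (hS.1 (by simp))
    have hy : y ∈ T := hU (hS.1 (by simp))
    have step : ∀ u ∈ T, ∀ w ∈ T, u ≠ w → w ≠ x₀ → L {u, w} = L {x₀, w} := by
      intro u hu w hw huw hw0
      by_cases hux : u = x₀
      · rw [hux]
      · rw [h u hu w hw x₀ hx₀ huw hw0 hux, pair_comm]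
    have star : ∀ w ∈ T, w ≠ x₀ → L {x₀, w} = L {x₀, y₀} := by
      intro w hw hw0
      by_cases hwy : w = y₀
      · rw [hwy]
      · rw [pair_comm x₀ w]
        exact h w hw x₀ hx₀ y₀ hy₀ hw0 hxy₀ hwy
    by_cases hy0 : y = x₀
    · rw [hy0, pair_comm]
      exact star x hx fun h => hxy (h.trans hy0.symm)
    · rw [step x hx y hy hxy hy0, star y hy hy0]

theorem exists_rigidOn {r : ℕ} (hr : 2 ≤ r) {T : Finset α} (hT : r + 4 ≤ #T)
    {L : Finset α → Finset ℕ} (hL : ∀ S, 2 ≤ #(L S)) :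
    ∃ f : Finset α → ℕ, (∀ S, f S ∈ L S) ∧ RigidOn r T f := by
  induction r, hr using Nat.le_induction generalizing T L with
  | base => exact exists_rigidOn_two hT hL
  | succ r hr ih =>
    obtain ⟨v, hv⟩ := card_pos.1 (show 0 < #T by omega)
    have hc := card_erase_of_mem hv
    obtain ⟨f, hfL, hf⟩ := ih (T := T.erase v) (L := fun S => L (insert v S)) (by omega)
      fun S => hL _
    have := exists_rigidOn_of_link (by omega) (notMem_erase v T) hL hfL hf
    rwa [insert_erase hv] at this

theorem exists_rigidOn_two_of_three_le_card {T : Finset α} (hT : 3 ≤ #T)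
    {L : Finset α → Finset ℕ} (hL : ∀ S, 3 ≤ #(L S)) :
    ∃ f : Finset α → ℕ, (∀ S, f S ∈ L S) ∧ RigidOn 2 T f := by
  have hL' : ∀ S, 2 ≤ #(L S) := fun S => (Nat.le_succ 2).trans (hL S)
  obtain ⟨U, hU, hUc⟩ := exists_subset_card_eq hT
  obtain ⟨S, hS⟩ : (powersetCard 2 U).Nonempty := powersetCard_nonempty.2 (by omega)
  exact exists_rigidOn_superset (by omega) hU hL' (exists_rigidOn_triangle hUc hL'
    ((hL S).trans (card_le_card (subset_biUnion_of_mem L hS))))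

end

/-! ### Automorphisms of Kneser graphs -/

/-- `φ` maps `r`-sets to `r`-sets with left inverse `φ'`, and maps any three `r`-sets contained in a
common `(r + 1)`-set to three such sets. -/
structure PreservesTriples {α : Type*} (r : ℕ) (φ φ' : Finset α → Finset α) : Prop where
  card : ∀ A, #A = r → #(φ A) = r
  left_inv : ∀ A, #A = r → φ' (φ A) = A
  triple : ∀ A B D U, #A = r → #B = r → #D = r → #U = r + 1 → A ⊆ U → B ⊆ U → D ⊆ U →
    ∃ U', #U' = r + 1 ∧ φ A ⊆ U' ∧ φ B ⊆ U' ∧ φ D ⊆ U'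

section

variable {α : Type*} [DecidableEq α]

theorem le_card_inter_of_subset {r : ℕ} {A B U : Finset α} (hA : #A = r + 1) (hB : #B = r + 1)
    (hU : #U = r + 2) (hAU : A ⊆ U) (hBU : B ⊆ U) : r ≤ #(A ∩ B) := by
  have h1 := card_union_add_card_inter A B
  have h2 := card_le_card (union_subset hAU hBU)
  omega

/-- The images of the (r+1)-sets through `C` pairwise meet in at least r points. The core is the
intersection of two of them. A third image missing a core point would lie in the union of those two,
of size r+2; pulling back by `φ'` would put `C` and three further points into an (r+2)-set. -/
theorem exists_image_core [Fintype α] {r : ℕ} (hr : r + 2 ≤ Fintype.card α)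
    {φ φ' : Finset α → Finset α} (h : PreservesTriples (r + 1) φ φ')
    (h' : PreservesTriples (r + 1) φ' φ) (C : Finset α) (hC : #C = r) :
    ∃ C', #C' = r ∧ ∀ A, #A = r + 1 → C ⊆ A → C' ⊆ φ A := by
  obtain ⟨x, hx, y, hy, hxy⟩ := one_lt_card.1
    (show 1 < #Cᶜ by rw [card_compl]; omega)
  rw [mem_compl] at hx hy
  have hins : ∀ z ∉ C, #(insert z C) = r + 1 := fun z hz => by rw [card_insert_of_notMem hz, hC]
  set A := insert x C with hA
  set B := insert y C with hB
  have hAc : #A = r + 1 := hins x hx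
  have hBc : #B = r + 1 := hins y hy
  have hpair : ∀ z w, z ∉ C → w ∉ C → z ≠ w → r ≤ #(φ (insert z C) ∩ φ (insert w C)) := by
    intro z w hz hw hzw
    obtain ⟨U, hU, h1, h2, -⟩ := h.triple (insert z C) (insert w C) (insert w C)
      (insert z (insert w C)) (hins z hz) (hins w hw) (hins w hw)
      (by rw [card_insert_of_notMem (by simp [hzw, hz]), hins w hw])
      (insert_subset_insert _ (subset_insert _ _)) (subset_insert _ _) (subset_insert _ _)
    exact le_card_inter_of_subset (h.card _ (hins z hz)) (h.card _ (hins w hw)) hU h1 h2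
  have hne : φ A ≠ φ B := by
    intro heq
    have hAB : A = B := by rw [← h.left_inv A hAc, heq, h.left_inv B hBc]
    have : x ∈ B := hAB ▸ mem_insert_self x C
    simp [hB, hxy, hx] at this
  have hinter : #(φ A ∩ φ B) = r := by
    refine le_antisymm ?_ (hpair x y hx hy hxy)
    by_contra hlt
    have h1 : φ A ∩ φ B = φ A := eq_of_subset_of_card_le inter_subset_left
      (by rw [h.card A hAc]; omega)
    have h2 : φ A ∩ φ B = φ B := eq_of_subset_of_card_le inter_subset_right
      (by rw [h.card B hBc]; omega)
    exact hne (h1.symm.trans h2)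
  have hunion : #(φ A ∪ φ B) = r + 2 := by
    have := card_union_add_card_inter (φ A) (φ B)
    rw [h.card A hAc, h.card B hBc, hinter] at this
    omega
  refine ⟨φ A ∩ φ B, hinter, fun D hDc hCD => ?_⟩
  obtain ⟨z, hz, rfl⟩ : ∃ z ∉ C, insert z C = D := by
    obtain ⟨z, hzD, hzC⟩ := exists_mem_notMem_of_card_lt_card (show #C < #D by omega)
    exact ⟨z, hzC, eq_of_subset_of_card_le (insert_subset hzD hCD) (by rw [hins z hzC, hDc])⟩
  by_cases hzx : z = x
  · rw [hzx]; exact inter_subset_left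
  by_cases hzy : z = y
  · rw [hzy]; exact inter_subset_right
  intro c hc
  by_contra hcD
  obtain ⟨hcA, hcB⟩ := mem_inter.1 hc
  have herase : ∀ E, #E = r + 1 → c ∈ E → r ≤ #(E ∩ φ (insert z C)) →
      E.erase c ⊆ φ (insert z C) := by
    intro E hE hcE hle
    have hsub : E ∩ φ (insert z C) ⊆ E.erase c := by
      intro w hw
      obtain ⟨h1, h2⟩ := mem_inter.1 hw
      exact mem_erase.2 ⟨fun h => hcD (h ▸ h2), h1⟩
    rw [← eq_of_subset_of_card_le hsub (by rw [card_erase_of_mem hcE]; omega)]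
    exact inter_subset_right
  have h1 := herase _ (h.card A hAc) hcA (hpair x z hx hz (Ne.symm hzx))
  have h2 := herase _ (h.card B hBc) hcB (hpair y z hy hz (Ne.symm hzy))
  have h3 : (φ A ∪ φ B).erase c = φ (insert z C) := by
    refine eq_of_subset_of_card_le ?_ ?_
    · rw [erase_union_distrib]
      exact union_subset h1 h2
    · rw [card_erase_of_mem (mem_union_left _ hcA), h.card _ hDc]; omega
  obtain ⟨U, hU, hAU, hBU, hDU⟩ := h'.triple (φ A) (φ B) (φ (insert z C)) (φ A ∪ φ B)
    (h.card A hAc) (h.card B hBc) (h.card _ hDc) hunion subset_union_left subset_union_right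
    (h3 ▸ erase_subset _ _)
  rw [h.left_inv A hAc] at hAU
  rw [h.left_inv B hBc] at hBU
  rw [h.left_inv _ hDc] at hDU
  have hbig : insert z (insert y A) ⊆ U :=
    insert_subset (hDU (mem_insert_self _ _)) (insert_subset (hBU (mem_insert_self _ _)) hAU)
  have hcard := card_le_card hbig
  rw [card_insert_of_notMem (by simp [hA, hzx, hzy, hz]),
    card_insert_of_notMem (by simp [hA, hxy.symm, hy])] at hcard
  omega

/-- Cores define the map one level down. The triple condition is then immediate, since `φ U`
contains the cores of all r-subsets of `U`. -/
theorem exists_preservesTriples_pred [Fintype α] {r : ℕ} (hr : r + 2 ≤ Fintype.card α)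
    {φ φ' : Finset α → Finset α} (h : PreservesTriples (r + 1) φ φ')
    (h' : PreservesTriples (r + 1) φ' φ) :
    ∃ ψ ψ' : Finset α → Finset α, PreservesTriples r ψ ψ' ∧ PreservesTriples r ψ' ψ ∧
      ∀ C A, #C = r → #A = r + 1 → C ⊆ A → ψ C ⊆ φ A := by
  choose! ψ hψc hψ using exists_image_core hr h h'
  choose! ψ' hψc' hψ' using exists_image_core hr h' h
  -- An r-set lying in every (r+1)-set through `C` is `C` itself, which shows that the two core maps
  -- are inverse.
  have hcap : ∀ C E : Finset α, #C = r → #E = r →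
      (∀ A, #A = r + 1 → C ⊆ A → E ⊆ A) → E = C := by
    intro C E hC hE hCE
    refine eq_of_subset_of_card_le (fun e he => ?_) (by omega)
    by_contra heC
    obtain ⟨x, hx⟩ := card_pos.1 (show 0 < #(insert e C)ᶜ by
      rw [card_compl, card_insert_of_notMem heC]; omega)
    rw [mem_compl, mem_insert, not_or] at hx
    have := hCE (insert x C) (by rw [card_insert_of_notMem hx.2, hC]) (subset_insert _ _) he
    exact (mem_insert.1 this).elim (fun h => hx.1 h.symm) heC
  have build : ∀ (φ φ' ψ ψ' : Finset α → Finset α), PreservesTriples (r + 1) φ φ' →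
      (∀ C, #C = r → #(ψ C) = r) → (∀ C, #C = r → #(ψ' C) = r) →
      (∀ C, #C = r → ∀ A, #A = r + 1 → C ⊆ A → ψ C ⊆ φ A) →
      (∀ C, #C = r → ∀ A, #A = r + 1 → C ⊆ A → ψ' C ⊆ φ' A) → PreservesTriples r ψ ψ' := by
    intro φ φ' ψ ψ' h hc hc' hs hs'
    refine ⟨hc, fun C hC => hcap C _ hC (hc' _ (hc C hC)) fun A hA hCA => ?_,
      fun A B D U hA hB hD hU hAU hBU hDU =>
        ⟨φ U, h.card U hU, hs A hA U hU hAU, hs B hB U hU hBU, hs D hD U hU hDU⟩⟩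
    have := hs' (ψ C) (hc C hC) (φ A) (h.card A hA) (hs C hC A hA hCA)
    rwa [h.left_inv A hA] at this
  exact ⟨ψ, ψ', build φ φ' ψ ψ' h hψc hψc' hψ hψ', build φ' φ ψ' ψ h' hψc' hψc hψ' hψ,
    fun C A hC hA hCA => hψ C hC A hA hCA⟩

/-- Descending to singletons, the map is visibly a permutation. On the way back up, the image of `A`
contains the images of the subsets one size smaller, which cover the image of `A` under the
permutation. -/
theorem PreservesTriples.exists_perm [Fintype α] {r : ℕ} (hr : r + 2 ≤ Fintype.card α)
    {φ φ' : Finset α → Finset α} (h : PreservesTriples (r + 1) φ φ')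
    (h' : PreservesTriples (r + 1) φ' φ) :
    ∃ σ : Equiv.Perm α, ∀ A, #A = r + 1 → φ A = A.map σ.toEmbedding := by
  induction r generalizing φ φ' with
  | zero =>
    have hφ : ∀ x, ∃ y, φ {x} = {y} := fun x => card_eq_one.1 (h.card {x} (card_singleton x))
    have hφ' : ∀ x, ∃ y, φ' {x} = {y} := fun x => card_eq_one.1 (h'.card {x} (card_singleton x))
    choose p hp using hφ
    choose q hq using hφ'
    refine ⟨⟨p, q, fun x => ?_, fun x => ?_⟩, fun A hA => ?_⟩
    · rw [← singleton_inj, ← hq, ← hp]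
      exact h.left_inv _ (card_singleton x)
    · rw [← singleton_inj, ← hp, ← hq]
      exact h'.left_inv _ (card_singleton x)
    · obtain ⟨x, rfl⟩ := card_eq_one.1 hA
      rw [hp, map_singleton]
      rfl
  | succ r ih =>
    obtain ⟨ψ, ψ', hψ, hψ', hsub⟩ := exists_preservesTriples_pred hr h h'
    obtain ⟨σ, hσ⟩ := ih (by omega) hψ hψ'
    refine ⟨σ, fun A hA => (eq_of_subset_of_card_le (fun y hy => ?_) ?_).symm⟩
    · obtain ⟨x, hx, rfl⟩ := mem_map.1 hy
      obtain ⟨C, hxC, hCA, hC⟩ := exists_subsuperset_card_eq (s := {x}) (t := A) (n := r + 1)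
        (singleton_subset_iff.2 hx) (by simp) (by omega)
      refine hsub C A hC hA hCA ?_
      rw [hσ C hC]
      exact mem_map_of_mem _ (singleton_subset_iff.1 hxC)
    · rw [h.card A hA, card_map, hA]

end

theorem Nat.choose_lt_choose_of_lt {m k r : ℕ} (hr : 1 ≤ r) (hk : r ≤ k) (hmk : m < k) :
    m.choose r < k.choose r := by
  obtain ⟨r, rfl⟩ := Nat.exists_eq_add_of_le' hr
  obtain ⟨k, rfl⟩ := Nat.exists_eq_add_of_le' (hr.trans hk)
  refine (Nat.choose_le_choose _ (Nat.lt_succ_iff.1 hmk)).trans_lt ?_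
  rw [Nat.choose_succ_succ, Nat.succ_eq_add_one]
  have := Nat.choose_pos (n := k) (k := r) (by omega)
  omega

/-- The action of a map on vertices of the Kneser graph as a map of finsets. -/
def kneserFinsetMap {n r : ℕ} (g : kneserGraph n r ≃g kneserGraph n r) (A : Finset (Fin n)) :
    Finset (Fin n) :=
  if h : #A = r then (g ⟨A, h⟩).1 else ∅

theorem kneserFinsetMap_of_card {n r : ℕ} (g : kneserGraph n r ≃g kneserGraph n r)
    {A : Finset (Fin n)} (h : #A = r) : kneserFinsetMap g A = (g ⟨A, h⟩).1 :=
  dif_pos h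

theorem card_kneserFinsetMap {n r : ℕ} (g : kneserGraph n r ≃g kneserGraph n r)
    {A : Finset (Fin n)} (h : #A = r) : #(kneserFinsetMap g A) = r := by
  rw [kneserFinsetMap_of_card g h]
  exact (g ⟨A, h⟩).2

theorem kneserFinsetMap_symm {n r : ℕ} (g : kneserGraph n r ≃g kneserGraph n r)
    {A : Finset (Fin n)} (h : #A = r) : kneserFinsetMap g.symm (kneserFinsetMap g A) = A := by
  rw [kneserFinsetMap_of_card g h, kneserFinsetMap_of_card g.symm (g ⟨A, h⟩).2]
  exact congrArg Subtype.val (g.symm_apply_apply ⟨A, h⟩)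

theorem disjoint_kneserFinsetMap {n r : ℕ} (hr : 1 ≤ r)
    (g : kneserGraph n r ≃g kneserGraph n r) {A B : Finset (Fin n)} (hA : #A = r) (hB : #B = r)
    (h : Disjoint A B) : Disjoint (kneserFinsetMap g A) (kneserFinsetMap g B) := by
  have hne : (⟨A, hA⟩ : {s : Finset (Fin n) // #s = r}) ≠ ⟨B, hB⟩ := by
    intro hAB
    obtain rfl : A = B := congrArg Subtype.val hAB
    rw [disjoint_self_iff_empty] at h
    subst h
    rw [card_empty] at hA
    omega
  have hadj : (kneserGraph n r).Adj ⟨A, hA⟩ ⟨B, hB⟩ := ⟨hne, h⟩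
  rw [kneserFinsetMap_of_card g hA, kneserFinsetMap_of_card g hB]
  exact (g.map_adj_iff.2 hadj).2

theorem preservesTriples_kneserFinsetMap {n r : ℕ} (hr : 1 ≤ r) (hn : 2 * r + 1 ≤ n)
    (g : kneserGraph n r ≃g kneserGraph n r) :
    PreservesTriples r (kneserFinsetMap g) (kneserFinsetMap g.symm) := by
  refine ⟨fun A => card_kneserFinsetMap g, fun A => kneserFinsetMap_symm g, ?_⟩
  intro A B D U hA hB hD hU hAU hBU hDU
  set W := kneserFinsetMap g A ∪ kneserFinsetMap g B ∪ kneserFinsetMap g D with hW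
  -- The map injects the r-sets disjoint from `U` into those disjoint from `W`. As n-(r+1) ≥ r, the
  -- binomial is strictly monotone there, which forces `W` to have at most r+1 points.
  have hle : #(powersetCard r Uᶜ) ≤ #(powersetCard r Wᶜ) := by
    refine card_le_card_of_injOn (kneserFinsetMap g) (fun S hS => ?_) (fun S hS S' hS' hSS => ?_)
    · rw [mem_coe, mem_powersetCard] at hS
      have hdisj : ∀ E ⊆ U, #E = r → Disjoint (kneserFinsetMap g S) (kneserFinsetMap g E) :=
        fun E hEU hE => disjoint_kneserFinsetMap hr g hS.2 hE
          ((subset_compl_iff_disjoint_right.1 hS.1).mono_right hEU)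
      rw [mem_coe, mem_powersetCard, subset_compl_iff_disjoint_right, hW, disjoint_union_right,
        disjoint_union_right]
      exact ⟨⟨⟨hdisj A hAU hA, hdisj B hBU hB⟩, hdisj D hDU hD⟩, card_kneserFinsetMap g hS.2⟩
    · rw [mem_coe, mem_powersetCard] at hS hS'
      rw [← kneserFinsetMap_symm g hS.2, hSS, kneserFinsetMap_symm g hS'.2]
  rw [card_powersetCard, card_powersetCard, card_compl, card_compl, Fintype.card_fin, hU] at hle
  have hWc : #W ≤ r + 1 := by
    by_contra hlt
    exact absurd hle (not_le.2 (Nat.choose_lt_choose_of_lt hr (by omega) (by omega)))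
  obtain ⟨U', hWU, -, hU'⟩ := exists_subsuperset_card_eq (subset_univ W) hWc
    (by rw [card_univ, Fintype.card_fin]; omega)
  exact ⟨U', hU', (subset_union_left.trans subset_union_left).trans hWU,
    (subset_union_right.trans subset_union_left).trans hWU, subset_union_right.trans hWU⟩

theorem kneserGraph_iso_eq_perm {n r : ℕ} (hr : 1 ≤ r) (hn : 2 * r + 1 ≤ n)
    (g : kneserGraph n r ≃g kneserGraph n r) :
    ∃ σ : Equiv.Perm (Fin n), ∀ v, (g v).1 = v.1.map σ.toEmbedding := by
  obtain ⟨r, rfl⟩ := Nat.exists_eq_add_of_le' hr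
  obtain ⟨σ, hσ⟩ := PreservesTriples.exists_perm (by rw [Fintype.card_fin]; omega)
    (preservesTriples_kneserFinsetMap hr hn g) (preservesTriples_kneserFinsetMap hr hn g.symm)
  refine ⟨σ, fun v => ?_⟩
  rw [← hσ v.1 v.2, kneserFinsetMap_of_card g v.2]

/-! ### Graphs on five vertices -/

/-- The graph on `Fin 5` with the given adjacencies `01`, `02`, `12`, `03`, `13`, `23`, `04`, `14`,
`24`, `34` is invariant under some transposition or some product of two disjoint transpositions. -/
def hasInvolution (a b c d e f g h i j : Bool) : Bool :=
  (b == c && d == e && g == h) ||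
  (a == c && d == f && g == i) ||
  (a == e && b == f && g == j) ||
  (a == h && b == i && d == j) ||
  (a == b && e == f && h == i) ||
  (a == d && c == f && h == j) ||
  (a == g && c == i && e == j) ||
  (b == d && c == e && i == j) ||
  (b == g && c == h && f == j) ||
  (d == g && e == h && f == i) ||
  -- The ten transpositions end here; the remaining fifteen clauses are the double transpositions.
  (g == h && i == j && b == e && d == c) ||
  (d == e && f == j && b == h && g == c) ||
  (b == c && f == i && d == h && g == e) ||
  (g == i && h == j && a == f && d == c) ||
  (d == f && e == j && a == i && g == c) ||
  (a == c && e == h && d == i && g == f) ||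
  (g == j && h == i && a == f && b == e) ||
  (b == f && c == i && a == j && g == e) ||
  (a == e && c == h && b == j && g == f) ||
  (d == j && e == f && a == i && b == h) ||
  (b == i && c == f && a == j && d == h) ||
  (a == h && c == e && b == j && d == i) ||
  (a == b && d == g && e == i && h == f) ||
  (a == d && b == g && c == j && h == f) ||
  (a == g && b == d && c == j && e == i)

theorem hasInvolution_eq_true :
    ∀ a b c d e f g h i j, hasInvolution a b c d e f g h i j = true := by
  decide +kernel

/-- With `min` and `max` the hypotheses below reduce to pairs of numerals in increasing order, as
they occur in `hasInvolution`. -/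
theorem pair_min_max {α : Type*} [LinearOrder α] (x y : α) :
    ({min x y, max x y} : Finset α) = {x, y} := by
  rcases le_total x y with h | h
  · rw [min_eq_left h, max_eq_right h]
  · rw [min_eq_right h, max_eq_left h, pair_comm]

section

variable {C : Type*} {g : Finset (Fin 5) → C}

theorem exists_perm_of_twins (i j k l m : Fin 5)
    (hnd : [i, j, k, l, m].Nodup) (hmem : ∀ x, x ∈ [i, j, k, l, m])
    (hk : g {min i k, max i k} = g {min j k, max j k}) (hl : g {min i l, max i l} = g {min j l, max j l}) (hm : g {min i m, max i m} = g {min j m, max j m}) :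
    ∃ σ : Equiv.Perm (Fin 5), σ ≠ 1 ∧ ∀ x y, x ≠ y → g {σ x, σ y} = g {x, y} := by
  simp only [pair_min_max] at *
  simp only [List.nodup_cons, List.mem_cons, List.not_mem_nil, or_false, not_or] at hnd hmem
  obtain ⟨⟨hij, hik, hil, him⟩, ⟨hjk, hjl, hjm⟩, ⟨hkl, hkm⟩, hlm, -⟩ := hnd
  have ek := Equiv.swap_apply_of_ne_of_ne (Ne.symm hik) (Ne.symm hjk)
  have el := Equiv.swap_apply_of_ne_of_ne (Ne.symm hil) (Ne.symm hjl)
  have em := Equiv.swap_apply_of_ne_of_ne (Ne.symm him) (Ne.symm hjm)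
  refine ⟨Equiv.swap i j, fun h => hij (Equiv.swap_eq_one_iff.1 h), fun x y hxy => ?_⟩
  rcases hmem x with rfl | rfl | rfl | rfl | rfl <;>
    rcases hmem y with rfl | rfl | rfl | rfl | rfl <;>
    simp only [Equiv.swap_apply_left, Equiv.swap_apply_right, ek, el, em] <;>
    simp_all [pair_comm]

theorem exists_perm_of_double_swap (i j k l m : Fin 5)
    (hnd : [i, j, k, l, m].Nodup) (hmem : ∀ x, x ∈ [i, j, k, l, m])
    (hij' : g {min i m, max i m} = g {min j m, max j m}) (hkl' : g {min k m, max k m} = g {min l m, max l m}) (hikjl : g {min i k, max i k} = g {min j l, max j l})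
    (hiljk : g {min i l, max i l} = g {min j k, max j k}) :
    ∃ σ : Equiv.Perm (Fin 5), σ ≠ 1 ∧ ∀ x y, x ≠ y → g {σ x, σ y} = g {x, y} := by
  simp only [pair_min_max] at *
  simp only [List.nodup_cons, List.mem_cons, List.not_mem_nil, or_false, not_or] at hnd hmem
  obtain ⟨⟨hij, hik, hil, him⟩, ⟨hjk, hjl, hjm⟩, ⟨hkl, hkm⟩, hlm, -⟩ := hnd
  have ei : (Equiv.swap i j * Equiv.swap k l) i = j := by
    rw [Equiv.Perm.mul_apply, Equiv.swap_apply_of_ne_of_ne hik hil, Equiv.swap_apply_left]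
  have ej : (Equiv.swap i j * Equiv.swap k l) j = i := by
    rw [Equiv.Perm.mul_apply, Equiv.swap_apply_of_ne_of_ne hjk hjl, Equiv.swap_apply_right]
  have ek : (Equiv.swap i j * Equiv.swap k l) k = l := by
    rw [Equiv.Perm.mul_apply, Equiv.swap_apply_left,
      Equiv.swap_apply_of_ne_of_ne (Ne.symm hil) (Ne.symm hjl)]
  have el : (Equiv.swap i j * Equiv.swap k l) l = k := by
    rw [Equiv.Perm.mul_apply, Equiv.swap_apply_right,
      Equiv.swap_apply_of_ne_of_ne (Ne.symm hik) (Ne.symm hjk)]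
  have em : (Equiv.swap i j * Equiv.swap k l) m = m := by
    rw [Equiv.Perm.mul_apply, Equiv.swap_apply_of_ne_of_ne (Ne.symm hkm) (Ne.symm hlm),
      Equiv.swap_apply_of_ne_of_ne (Ne.symm him) (Ne.symm hjm)]
  refine ⟨Equiv.swap i j * Equiv.swap k l, fun h => hij ?_, fun x y hxy => ?_⟩
  · rw [h] at ei
    exact ei
  rcases hmem x with rfl | rfl | rfl | rfl | rfl <;>
    rcases hmem y with rfl | rfl | rfl | rfl | rfl <;>
    simp only [ei, ej, ek, el, em] <;>
    simp_all [pair_comm]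

end

/-- Every graph on five vertices has a nontrivial automorphism. -/
theorem exists_perm_ne_one_of_five (g : Finset (Fin 5) → Bool) :
    ∃ σ : Equiv.Perm (Fin 5), σ ≠ 1 ∧ ∀ x y, x ≠ y → g {σ x, σ y} = g {x, y} := by
  have h := hasInvolution_eq_true (g {0, 1}) (g {0, 2}) (g {1, 2}) (g {0, 3}) (g {1, 3})
    (g {2, 3}) (g {0, 4}) (g {1, 4}) (g {2, 4}) (g {3, 4})
  simp only [hasInvolution, Bool.or_eq_true, Bool.and_eq_true, beq_iff_eq, or_assoc] at h
  rcases h with h | h | h | h | h | h | h | h | h | h | h | h | h | h | h | h | h | h | h | h | h |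
    h | h | h | h
  · exact exists_perm_of_twins 0 1 2 3 4 (by decide) (by decide) h.1.1 h.1.2 h.2
  · exact exists_perm_of_twins 0 2 1 3 4 (by decide) (by decide) h.1.1 h.1.2 h.2
  · exact exists_perm_of_twins 0 3 1 2 4 (by decide) (by decide) h.1.1 h.1.2 h.2
  · exact exists_perm_of_twins 0 4 1 2 3 (by decide) (by decide) h.1.1 h.1.2 h.2
  · exact exists_perm_of_twins 1 2 0 3 4 (by decide) (by decide) h.1.1 h.1.2 h.2
  · exact exists_perm_of_twins 1 3 0 2 4 (by decide) (by decide) h.1.1 h.1.2 h.2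
  · exact exists_perm_of_twins 1 4 0 2 3 (by decide) (by decide) h.1.1 h.1.2 h.2
  · exact exists_perm_of_twins 2 3 0 1 4 (by decide) (by decide) h.1.1 h.1.2 h.2
  · exact exists_perm_of_twins 2 4 0 1 3 (by decide) (by decide) h.1.1 h.1.2 h.2
  · exact exists_perm_of_twins 3 4 0 1 2 (by decide) (by decide) h.1.1 h.1.2 h.2
  · exact exists_perm_of_double_swap 0 1 2 3 4 (by decide) (by decide) h.1.1.1
      h.1.1.2 h.1.2 h.2
  · exact exists_perm_of_double_swap 0 1 2 4 3 (by decide) (by decide) h.1.1.1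
      h.1.1.2 h.1.2 h.2
  · exact exists_perm_of_double_swap 0 1 3 4 2 (by decide) (by decide) h.1.1.1
      h.1.1.2 h.1.2 h.2
  · exact exists_perm_of_double_swap 0 2 1 3 4 (by decide) (by decide) h.1.1.1
      h.1.1.2 h.1.2 h.2
  · exact exists_perm_of_double_swap 0 2 1 4 3 (by decide) (by decide) h.1.1.1
      h.1.1.2 h.1.2 h.2
  · exact exists_perm_of_double_swap 0 2 3 4 1 (by decide) (by decide) h.1.1.1
      h.1.1.2 h.1.2 h.2
  · exact exists_perm_of_double_swap 0 3 1 2 4 (by decide) (by decide) h.1.1.1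
      h.1.1.2 h.1.2 h.2
  · exact exists_perm_of_double_swap 0 3 1 4 2 (by decide) (by decide) h.1.1.1
      h.1.1.2 h.1.2 h.2
  · exact exists_perm_of_double_swap 0 3 2 4 1 (by decide) (by decide) h.1.1.1
      h.1.1.2 h.1.2 h.2
  · exact exists_perm_of_double_swap 0 4 1 2 3 (by decide) (by decide) h.1.1.1
      h.1.1.2 h.1.2 h.2
  · exact exists_perm_of_double_swap 0 4 1 3 2 (by decide) (by decide) h.1.1.1
      h.1.1.2 h.1.2 h.2
  · exact exists_perm_of_double_swap 0 4 2 3 1 (by decide) (by decide) h.1.1.1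
      h.1.1.2 h.1.2 h.2
  · exact exists_perm_of_double_swap 1 2 3 4 0 (by decide) (by decide) h.1.1.1
      h.1.1.2 h.1.2 h.2
  · exact exists_perm_of_double_swap 1 3 2 4 0 (by decide) (by decide) h.1.1.1
      h.1.1.2 h.1.2 h.2
  · exact exists_perm_of_double_swap 1 4 2 3 0 (by decide) (by decide) h.1.1.1
      h.1.1.2 h.1.2 h.2

/-! ### From rigid colorings to distinguishing numbers -/

theorem apply_eq_of_image_preimage_eq {V C : Type*} {σ : V → V} {f : V → C}
    (h : ∀ c, σ '' (f ⁻¹' {c}) = f ⁻¹' {c}) (v : V) : f (σ v) = f v := by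
  have : σ v ∈ f ⁻¹' {f v} := by
    rw [← h]
    exact Set.mem_image_of_mem σ rfl
  exact this

theorem image_preimage_eq_of_apply_eq {V C : Type*} (σ : V ≃ V) {f : V → C}
    (h : ∀ v, f (σ v) = f v) (c : C) : σ '' (f ⁻¹' {c}) = f ⁻¹' {c} := by
  ext v
  rw [σ.image_eq_preimage_symm, Set.mem_preimage, Set.mem_preimage, Set.mem_preimage]
  rw [← h (σ.symm v), σ.apply_symm_apply]

/-- The automorphism of the Kneser graph induced by a permutation of the ground set. -/
def kneserPerm {n : ℕ} (r : ℕ) (σ : Equiv.Perm (Fin n)) : kneserGraph n r ≃g kneserGraph n r where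
  toEquiv := σ.finsetCongr.subtypeEquiv fun s => by simp
  map_rel_iff' {u v} := by
    refine and_congr (not_congr (Equiv.apply_eq_iff_eq _)) ?_
    exact disjoint_map σ.toEmbedding

theorem coe_kneserPerm {n r : ℕ} (σ : Equiv.Perm (Fin n)) (v : {s : Finset (Fin n) // #s = r}) :
    (kneserPerm r σ v).1 = v.1.map σ.toEmbedding :=
  rfl

theorem kneserPerm_ne_refl {n r : ℕ} (hr : 1 ≤ r) (hn : r < n) {σ : Equiv.Perm (Fin n)}
    (hσ : σ ≠ 1) : kneserPerm r σ ≠ RelIso.refl _ := by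
  intro h
  refine hσ (Equiv.ext fun x => perm_apply_eq_of_map_eq hr (T := univ)
    (by rwa [card_univ, Fintype.card_fin]) (by simp) (fun S _ hS => ?_) (mem_univ x))
  rw [← coe_kneserPerm σ ⟨S, hS⟩, h]
  rfl

theorem not_isDistinguishing_of_perm {n r : ℕ} (hr : 1 ≤ r) (hn : r < n) {C : Type*}
    {f : {s : Finset (Fin n) // #s = r} → C} {σ : Equiv.Perm (Fin n)} (hσ : σ ≠ 1)
    (hf : ∀ v, f (kneserPerm r σ v) = f v) : ¬ IsDistinguishing (kneserGraph n r) f := fun h =>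
  kneserPerm_ne_refl hr hn hσ (h _ fun c =>
    image_preimage_eq_of_apply_eq (kneserPerm r σ).toEquiv hf c)

theorem isListDistinguishable_of_rigidOn {n r : ℕ} (hr : 1 ≤ r) (hn : 2 * r + 1 ≤ n)
    {L : {s : Finset (Fin n) // #s = r} → Finset ℕ} {f : Finset (Fin n) → ℕ}
    (hfL : ∀ v, f v.1 ∈ L v) (hf : RigidOn r univ f) :
    IsListDistinguishable (kneserGraph n r) L := by
  refine ⟨fun v => f v.1, hfL, fun g hg => ?_⟩
  obtain ⟨σ, hσ⟩ := kneserGraph_iso_eq_perm hr hn g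
  have hfix := hf σ (by simp) fun S _ hS => by
    rw [← hσ ⟨S, hS⟩]
    exact apply_eq_of_image_preimage_eq (f := fun v : {s : Finset (Fin n) // #s = r} => f v.1)
      hg ⟨S, hS⟩
  obtain rfl : σ = 1 := Equiv.ext fun x => hfix x (mem_univ x)
  exact RelIso.ext fun v => Subtype.ext ((hσ v).trans map_refl)

theorem isListDistinguishable_of_exists_rigidOn {n r k : ℕ} (hr : 1 ≤ r) (hn : 2 * r + 1 ≤ n)
    (h : ∀ L : Finset (Fin n) → Finset ℕ, (∀ S, k ≤ #(L S)) →
      ∃ f : Finset (Fin n) → ℕ, (∀ S, f S ∈ L S) ∧ RigidOn r univ f)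
    (L : {s : Finset (Fin n) // #s = r} → Finset ℕ) (hL : ∀ v, #(L v) = k) :
    IsListDistinguishable (kneserGraph n r) L := by
  -- Sets of the wrong size are not vertices; they receive a dummy list of size k.
  obtain ⟨f, hfL, hf⟩ := h (fun S => if hS : #S = r then L ⟨S, hS⟩ else range k) fun S => by
    split_ifs
    · exact (hL _).ge
    · exact (card_range k).ge
  refine isListDistinguishable_of_rigidOn hr hn (fun v => ?_) hf
  have := hfL v.1
  rwa [dif_pos v.2] at this

theorem isDistinguishable_of_forall_list {V : Type*} {G : SimpleGraph V} {k : ℕ}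
    (h : ∀ L : V → Finset ℕ, (∀ v, #(L v) = k) → IsListDistinguishable G L) :
    IsDistinguishable G k := by
  obtain ⟨f, hfL, hf⟩ := h (fun _ => range k) fun _ => card_range k
  refine ⟨fun v => ⟨f v, mem_range.1 (hfL v)⟩, fun σ hσ => hf σ fun c => ?_⟩
  refine image_preimage_eq_of_apply_eq σ.toEquiv (fun v => ?_) c
  exact congrArg Fin.val (apply_eq_of_image_preimage_eq hσ v)

/-- If `k` lists colors always suffice and fewer than `k` plain colors never do, then both
distinguishing numbers equal `k`. -/
theorem distinguishingNumbers_eq {V : Type*} [Finite V] {G : SimpleGraph V} {k : ℕ}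
    (h : ∀ L : V → Finset ℕ, (∀ v, #(L v) = k) → IsListDistinguishable G L)
    (hlt : ∀ m < k, ¬ IsDistinguishable G m) :
    listDistinguishingNumber G = k ∧ distinguishingNumber G = k := by
  constructor
  · refine le_antisymm (Nat.sInf_le h) (le_csInf ⟨k, h⟩ fun m hm => not_lt.1 fun hmk => ?_)
    exact hlt m hmk (isDistinguishable_of_forall_list hm)
  · have hk : IsDistinguishable G k := isDistinguishable_of_forall_list h
    exact le_antisymm (Nat.sInf_le hk) (le_csInf ⟨k, hk⟩ fun m hm => not_lt.1 fun hmk => hlt m hmk hm)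

theorem not_isDistinguishable_kneserGraph {n r m : ℕ} (hr : 1 ≤ r) (hn : r < n) (hm : m < 2) :
    ¬ IsDistinguishable (kneserGraph n r) m := by
  rintro ⟨f, hf⟩
  have : Subsingleton (Fin m) := Fin.subsingleton_iff_le_one.2 (by omega)
  refine not_isDistinguishing_of_perm hr hn
    (σ := Equiv.swap ⟨0, by omega⟩ ⟨1, by omega⟩) (fun h => ?_) (fun v => Subsingleton.elim _ _) hf
  simpa using Equiv.swap_eq_one_iff.1 h

/-- A 2-coloring of the pairs is a graph on five points, and any nontrivial automorphism of it
preserves the coloring. -/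
theorem not_isDistinguishable_petersen : ¬ IsDistinguishable (kneserGraph 5 2) 2 := by
  rintro ⟨f, hf⟩
  let g : Finset (Fin 5) → Bool := fun S => if hS : #S = 2 then decide (f ⟨S, hS⟩ = 0) else false
  obtain ⟨σ, hσ, hg⟩ := exists_perm_ne_one_of_five g
  refine not_isDistinguishing_of_perm one_le_two (by decide) hσ (fun v => ?_) hf
  have hgv : ∀ v : {s : Finset (Fin 5) // #s = 2}, g v.1 = decide (f v = 0) := fun v =>
    dif_pos v.2
  obtain ⟨x, y, hxy, hv⟩ := card_eq_two.1 v.2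
  have h := hg x y hxy
  have himg : ({σ x, σ y} : Finset (Fin 5)) = (kneserPerm 2 σ v).1 := by
    rw [coe_kneserPerm, hv, map_insert, map_singleton]
    rfl
  rw [himg, ← hv, hgv, hgv, decide_eq_decide] at h
  omega

theorem theorem1 (n r : ℕ) (hr : 2 ≤ r) (hn : 2 * r + 1 ≤ n) :
    listDistinguishingNumber (kneserGraph n r) = distinguishingNumber (kneserGraph n r) ∧
      (¬ (n = 5 ∧ r = 2) → listDistinguishingNumber (kneserGraph n r) = 2) ∧
      (n = 5 ∧ r = 2 → listDistinguishingNumber (kneserGraph n r) = 3) := by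
  by_cases h : n = 5 ∧ r = 2
  · obtain ⟨rfl, rfl⟩ := h
    obtain ⟨h1, h2⟩ := distinguishingNumbers_eq (G := kneserGraph 5 2) (k := 3)
      (isListDistinguishable_of_exists_rigidOn one_le_two le_rfl fun L hL =>
        exists_rigidOn_two_of_three_le_card (by decide) hL) (fun m hm => by
        rcases Nat.lt_succ_iff_lt_or_eq.1 hm with hm | rfl
        · exact not_isDistinguishable_kneserGraph one_le_two (by decide) hm
        · exact not_isDistinguishable_petersen)
    exact ⟨h1.trans h2.symm, fun h => absurd ⟨rfl, rfl⟩ h, fun _ => h1⟩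
  · obtain ⟨h1, h2⟩ := distinguishingNumbers_eq (G := kneserGraph n r) (k := 2)
      (isListDistinguishable_of_exists_rigidOn (by omega) hn fun L hL =>
        -- Here r+4 ≤ n: for r ≥ 3 because 2r+1 ≥ r+4, and for r = 2 because n ≠ 5.
        exists_rigidOn hr (by rw [card_univ, Fintype.card_fin]; omega) hL)
      (fun m hm => not_isDistinguishable_kneserGraph (by omega) (by omega) hm)
    exact ⟨h1.trans h2.symm, fun _ => h1, fun h' => absurd h' h⟩
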